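/- Let $H$ be a division ring of finite dimension over its center $Z(H)$, let $n$ be a positive integer, and let $T_1,\dots,T_n$ be independent central variables. Let $H(T_1,\dots,T_n)$ be the quotient skew field of the Ore domain $H[T_1,\dots,T_n]$, and let $Z(H)(T_1,\dots,T_n)$ be its subfield generated by $Z(H)$ and $T_1,\dots,T_n$. For a division subring $F$ of $H(T_1,\dots,T_n)$ and an element $x$, let $F(x)$ denote the intersection of all division subrings of $H(T_1,\dots,T_n)$ containing $F$ and $x$. Call $x$ algebraic over $F$ if $F(x)$ is finite-dimensional as a left $F$-vector space, and call an extension $E/F$ of division subrings (so $F\subseteq E$) algebraic if every element of $E$ is algebraic over $F$. Let $L$ be a division ring with $H\subseteq L\subseteq H(T_1,\dots,T_n)$. (1) If $n=1$ and $L\neq H$, then there exists $f\in Z(H)(T_1)\setminus Z(H)$ such that $L=H(f)$. (2) If there exists $g\in Z(H)(T_1,\dots,T_n)$ such that $H(g)\subseteq L$, the extension $L/H(g)$ is algebraic, and $g$ is not algebraic over $H$, then there exists $f\in Z(H)(T_1,\dots,T_n)\setminus Z(H)$ such that $L=H(f)$. -/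

import Mathlib

/-- The ring `H[T₁, …, Tₙ]` of polynomials over `H` in `n` central variables: finite left
`H`-linear combinations of monomials, where coefficients commute with monomials. -/
abbrev CentralPoly (H : Type*) [DivisionRing H] (n : ℕ) : Type _ :=
  AddMonoidAlgebra H (Fin n →₀ ℕ)

namespace CentralPoly

variable {H : Type*} [DivisionRing H] {n : ℕ}

/-- All exponents occurring in `p` are below `m`. -/
def Bdd (m : ℕ) (p : CentralPoly H n) : Prop :=
  ∀ x ∈ p.coeff.support, ∀ i, x i < m

theorem exists_bdd (p : CentralPoly H n) : ∃ e, Bdd (e + 1) p :=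
  ⟨∑ x ∈ p.coeff.support, ∑ i, x i, fun x hx i => Nat.lt_succ_of_le <|
    (Finset.single_le_sum (f := fun i => x i) (fun _ _ => Nat.zero_le _) (Finset.mem_univ i)).trans
      (Finset.single_le_sum (f := fun x : Fin n →₀ ℕ => ∑ i, x i)
        (fun _ _ => Nat.zero_le _) hx)⟩

theorem Bdd.mono {m k : ℕ} (h : m ≤ k) {p : CentralPoly H n} (hp : Bdd m p) : Bdd k p :=
  fun x hx i => (hp x hx i).trans_le h

theorem Bdd.mul {m e : ℕ} {p q : CentralPoly H n} (hp : Bdd m p) (hq : Bdd (e + 1) q) :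
    Bdd (m + e) (p * q) := by
  classical
  intro x hx i
  have := AddMonoidAlgebra.support_coeff_mul_subset p q hx
  obtain ⟨y, hy, z, hz, rfl⟩ := Finset.mem_add.1 this
  have h1 := hp y hy i
  have h2 := hq z hz i
  simp only [Finsupp.add_apply]
  omega

/-- The polynomial with prescribed coefficients at the exponents with all entries below `m`. -/
noncomputable def ofBox (m : ℕ) : ((Fin n → Fin m) → H) →ₗ[H] CentralPoly H n :=
  ∑ v : Fin n → Fin m,
    (AddMonoidAlgebra.lsingle (R := H) (Finsupp.equivFunOnFinite.symm fun i => (v i : ℕ))) ∘ₗ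
      LinearMap.proj v

theorem exists_pow_lt (n e : ℕ) : ∃ m : ℕ, (m + e) ^ n < 2 * m ^ n := by
  have h : Filter.Tendsto (fun m : ℕ => (1 + (e : ℝ) / m) ^ n) Filter.atTop (nhds ((1 + 0) ^ n)) :=
    ((tendsto_const_div_atTop_nhds_zero_nat (e : ℝ)).const_add 1).pow n
  rw [add_zero, one_pow] at h
  obtain ⟨m, hm, hm0⟩ := ((h.eventually (gt_mem_nhds one_lt_two)).and
    (Filter.eventually_gt_atTop 0)).exists
  refine ⟨m, ?_⟩
  have hm' : (0 : ℝ) < m := by exact_mod_cast hm0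
  have : ((m : ℝ) + e) ^ n < 2 * (m : ℝ) ^ n := by
    have h2 : (m : ℝ) + e = (1 + (e : ℝ) / m) * m := by field_simp
    rw [h2, mul_pow]
    gcongr
  exact_mod_cast this

theorem coeff_ofBox (m : ℕ) (c : (Fin n → Fin m) → H) (x : Fin n →₀ ℕ) :
    (ofBox m c).coeff x = if h : ∀ i, x i < m then c fun i => ⟨x i, h i⟩ else 0 := by
  classical
  simp only [ofBox, LinearMap.sum_apply, LinearMap.comp_apply, LinearMap.proj_apply,
    AddMonoidAlgebra.lsingle_apply, AddMonoidAlgebra.coeff_sum, AddMonoidAlgebra.coeff_single,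
    Finsupp.finsetSum_apply, Finsupp.single_apply]
  split_ifs with h
  · rw [Finset.sum_eq_single fun i => ⟨x i, h i⟩]
    · rw [if_pos]
      ext i
      simp
    · intro v _ hv
      rw [if_neg]
      rintro rfl
      exact hv (by ext i; simp)
    · simp
  · refine Finset.sum_eq_zero fun v _ => if_neg ?_
    rintro rfl
    exact h fun i => by simp

/-- The left Ore condition for `H[T₁, …, Tₙ]`, by counting dimensions over `H`. -/
theorem exists_mul_eq_mul (r s : CentralPoly H n) (hs : s ≠ 0) :
    ∃ a b : CentralPoly H n, a ≠ 0 ∧ a * r = b * s := by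
  obtain ⟨e₁, h₁⟩ := exists_bdd r
  obtain ⟨e₂, h₂⟩ := exists_bdd s
  set e := max e₁ e₂
  replace h₁ : Bdd (e + 1) r := h₁.mono (by omega)
  replace h₂ : Bdd (e + 1) s := h₂.mono (by omega)
  obtain ⟨m, hm⟩ := exists_pow_lt n e
  have hb : ∀ c : (Fin n → Fin m) → H, Bdd m (ofBox m c) := by
    intro c x hx i
    rw [Finsupp.mem_support_iff, coeff_ofBox] at hx
    by_contra hi
    exact hx (dif_neg fun h => hi (h i))
  let F : (((Fin n → Fin m) → H) × ((Fin n → Fin m) → H)) →ₗ[H] CentralPoly H n :=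
    { toFun := fun c => ofBox m c.1 * r - ofBox m c.2 * s
      map_add' := fun c d => by simp only [Prod.fst_add, Prod.snd_add, map_add, add_mul]; abel
      map_smul' := fun t c => by
        simp only [Prod.smul_fst, Prod.smul_snd, map_smul, smul_mul_assoc, smul_sub,
          RingHom.id_apply] }
  let P : CentralPoly H n →ₗ[H] ((Fin n → Fin (m + e)) → H) :=
    { toFun := fun p v => p.coeff (Finsupp.equivFunOnFinite.symm fun i => (v i : ℕ))
      map_add' := fun p q => by ext; simp
      map_smul' := fun t p => by ext; simp }
  have hk : LinearMap.ker (P ∘ₗ F) ≠ ⊥ := by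
    apply LinearMap.ker_ne_bot_of_finrank_lt
    simp only [Module.finrank_prod, Module.finrank_fintype_fun_eq_card, Fintype.card_fun,
      Fintype.card_fin]
    omega
  obtain ⟨c, hc, hc0⟩ := Submodule.exists_mem_ne_zero_of_ne_bot hk
  have hF : F c = 0 := by
    have hsupp : Bdd (m + e) (F c) := by
      classical
      intro x hx
      have hx' : x ∈ (ofBox m c.1 * r).coeff.support ∪ (ofBox m c.2 * s).coeff.support := by
        by_contra hn
        simp only [Finset.mem_union, Finsupp.mem_support_iff, not_or, not_not] at hn
        refine Finsupp.mem_support_iff.1 hx ?_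
        change (ofBox m c.1 * r - ofBox m c.2 * s).coeff x = 0
        simp [hn.1, hn.2]
      rcases Finset.mem_union.1 hx' with h | h
      · exact ((hb c.1).mul h₁) x h
      · exact ((hb c.2).mul h₂) x h
    ext x
    by_contra hx
    have hlt := hsupp x (Finsupp.mem_support_iff.2 hx)
    apply hx
    have := congrFun (LinearMap.mem_ker.1 hc) fun i => ⟨x i, hlt i⟩
    change (F c).coeff (Finsupp.equivFunOnFinite.symm fun i => x i) = 0 at this
    have hxe : (Finsupp.equivFunOnFinite.symm fun i => x i) = x := by ext i; simp
    rw [hxe] at this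
    simpa using this
  have heq : ofBox m c.1 * r = ofBox m c.2 * s := sub_eq_zero.1 hF
  have hinj : ∀ d : (Fin n → Fin m) → H, ofBox m d = 0 → d = 0 := by
    intro d hd
    ext v
    have := coeff_ofBox m d (Finsupp.equivFunOnFinite.symm fun i => (v i : ℕ))
    rw [hd, dif_pos fun i => by simp] at this
    simpa using this.symm
  refine ⟨ofBox m c.1, ofBox m c.2, fun h0 => hc0 ?_, heq⟩
  rw [h0, zero_mul] at heq
  have h2 : ofBox m c.2 = 0 := (mul_eq_zero.1 heq.symm).resolve_right hs
  exact Prod.ext (hinj _ h0) (hinj _ h2)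

/-- The ring isomorphism `H[T₁, …, Tₙ]ᵒᵖ ≃ Hᵒᵖ[T₁, …, Tₙ]`. -/
noncomputable def opEquiv : (CentralPoly H n)ᵐᵒᵖ ≃+* CentralPoly Hᵐᵒᵖ n :=
  AddMonoidAlgebra.opRingEquiv.trans
    (AddMonoidAlgebra.mapDomainRingEquiv Hᵐᵒᵖ (AddOpposite.opAddEquiv (M := Fin n →₀ ℕ)).symm)

/-- The right Ore condition for `H[T₁, …, Tₙ]`. -/
theorem exists_mul_eq_mul' (r s : CentralPoly H n) (hs : s ≠ 0) :
    ∃ a b : CentralPoly H n, a ≠ 0 ∧ r * a = s * b := by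
  obtain ⟨a, b, ha, hab⟩ := exists_mul_eq_mul (opEquiv (.op r)) (opEquiv (.op s)) (by simpa using hs)
  refine ⟨(opEquiv.symm a).unop, (opEquiv.symm b).unop, by simpa using ha, ?_⟩
  apply MulOpposite.op_injective
  apply opEquiv.injective
  simpa using hab

open scoped nonZeroDivisors in
noncomputable instance instOreSet : OreLocalization.OreSet (CentralPoly H n)⁰ where
  ore_right_cancel r₁ r₂ s h :=
    ⟨1, by rw [mul_right_cancel₀ (nonZeroDivisors.ne_zero s.2) h]⟩
  oreNum r s := (exists_mul_eq_mul r s (nonZeroDivisors.ne_zero s.2)).choose_spec.choose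
  oreDenom r s := ⟨(exists_mul_eq_mul r s (nonZeroDivisors.ne_zero s.2)).choose,
    mem_nonZeroDivisors_of_ne_zero
      (exists_mul_eq_mul r s (nonZeroDivisors.ne_zero s.2)).choose_spec.choose_spec.1⟩
  ore_eq r s := (exists_mul_eq_mul r s (nonZeroDivisors.ne_zero s.2)).choose_spec.choose_spec.2

end CentralPoly

open scoped nonZeroDivisors in
/-- The division ring `H(T₁, …, Tₙ)`: the quotient skew field of `H[T₁, …, Tₙ]`. -/
def CentralRat (H : Type*) [DivisionRing H] (n : ℕ) : Type _ :=
  OreLocalization (CentralPoly H n)⁰ (CentralPoly H n)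

namespace CentralRat

open scoped nonZeroDivisors in
noncomputable instance instDivisionRing (H : Type*) [DivisionRing H] (n : ℕ) :
    DivisionRing (CentralRat H n) :=
  inferInstanceAs (DivisionRing (OreLocalization (CentralPoly H n)⁰ (CentralPoly H n)))

open scoped nonZeroDivisors in
/-- The inclusion of `H[T₁, …, Tₙ]` in `H(T₁, …, Tₙ)`. -/
noncomputable def ofPoly (H : Type*) [DivisionRing H] (n : ℕ) :
    CentralPoly H n →+* CentralRat H n :=
  (OreLocalization.numeratorRingHom :
    CentralPoly H n →+* OreLocalization (CentralPoly H n)⁰ (CentralPoly H n))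

theorem ofPoly_injective (H : Type*) [DivisionRing H] (n : ℕ) :
    Function.Injective (ofPoly H n) :=
  OreLocalization.numeratorHom_inj fun _ hx => hx.1

/-- Every element of `H(T₁, …, Tₙ)` is a right fraction `a b⁻¹` of polynomials. -/
theorem exists_eq_mul_inv {H : Type*} [DivisionRing H] {n : ℕ} (x : CentralRat H n) :
    ∃ a b : CentralPoly H n, b ≠ 0 ∧ x = ofPoly H n a * (ofPoly H n b)⁻¹ := by
  have h0 : ∀ {p : CentralPoly H n}, p ≠ 0 → ofPoly H n p ≠ 0 := fun hp =>
    (map_ne_zero_iff _ (ofPoly_injective H n)).2 hp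
  obtain ⟨r, s, hx⟩ : ∃ (r : CentralPoly H n) (s : nonZeroDivisors (CentralPoly H n)),
      ofPoly H n s * x = ofPoly H n r :=
    OreLocalization.ind (β := fun y : CentralRat H n => ∃ (r : CentralPoly H n)
      (s : nonZeroDivisors (CentralPoly H n)), ofPoly H n s * y = ofPoly H n r)
      (fun r s => ⟨r, s, OreLocalization.mul_cancel⟩) x
  have hs : (s : CentralPoly H n) ≠ 0 := nonZeroDivisors.ne_zero s.2
  obtain ⟨b, a, hb, hab⟩ := CentralPoly.exists_mul_eq_mul' r s hs
  refine ⟨a, b, hb, ?_⟩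
  rw [eq_mul_inv_iff_mul_eq₀ (h0 hb)]
  apply mul_left_cancel₀ (h0 hs)
  rw [← map_mul, ← hab, map_mul, ← mul_assoc, hx]

/-- The inclusion of `H` in `H(T₁, …, Tₙ)`. -/
noncomputable def C (H : Type*) [DivisionRing H] (n : ℕ) : H →+* CentralRat H n :=
  (ofPoly H n).comp AddMonoidAlgebra.singleZeroRingHom

/-- The variable `Tᵢ` in `H(T₁, …, Tₙ)`. -/
noncomputable def T (H : Type*) [DivisionRing H] {n : ℕ} (i : Fin n) : CentralRat H n :=
  ofPoly H n (AddMonoidAlgebra.single (Finsupp.single i 1) 1)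

/-- `H` as a division subring of `H(T₁, …, Tₙ)`. -/
noncomputable def base (H : Type*) [DivisionRing H] (n : ℕ) : Subfield (CentralRat H n) :=
  (C H n).fieldRange

/-- `Z(H)` as a subset of `H(T₁, …, Tₙ)`. -/
def centerBase (H : Type*) [DivisionRing H] (n : ℕ) : Set (CentralRat H n) :=
  C H n '' Set.center H

/-- `Z(H)(T₁, …, Tₙ)` inside `H(T₁, …, Tₙ)`: the division subring generated by `Z(H)` and the
variables. -/
noncomputable def centerRat (H : Type*) [DivisionRing H] (n : ℕ) : Subfield (CentralRat H n) :=
  Subfield.closure (centerBase H n ∪ Set.range (T H))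

end CentralRat

namespace DivisionSubring

variable {K : Type*} [DivisionRing K]

/-- `F(S)`: the intersection of all division subrings containing `F` and `S`. -/
def adjoin (F : Subfield K) (S : Set K) : Subfield K :=
  Subfield.closure ((F : Set K) ∪ S)

/-- `E/F` is a finite extension: `E`, as a left `F`-linear subspace of `K`, is
finite-dimensional. -/
def IsFiniteExt (F E : Subfield K) : Prop :=
  ∃ V : Submodule F K, (V : Set K) = E ∧ FiniteDimensional F V

/-- The element `x` is algebraic over `F`: the extension `F(x)/F` is finite. -/
def IsAlgebraicElem (F : Subfield K) (x : K) : Prop :=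
  IsFiniteExt F (adjoin F {x})

/-- `E/F` is an algebraic extension. -/
def IsAlgebraicExt (F E : Subfield K) : Prop :=
  F ≤ E ∧ ∀ x ∈ E, IsAlgebraicElem F x

end DivisionSubring

/-!
Write `Z` for the center of `H`, `D = H(T₁, …, Tₙ)` and `E = Z(T₁, …, Tₙ)`, a central subfield
of `D`.

Let `H ⊆ L ⊆ D`. Since `H` is a simple bimodule over itself with only the central elements as
bimodule endomorphisms, the Jacobson density theorem writes every `Z`-linear endomorphism of `H`
as a sum `∑ aₛ x bₛ` (`DivisionRing.exists_eq_sum_mul_mul`). On the other hand `D = H · E`: the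
`E`-linear combinations of elements of `H` form a domain finite-dimensional over `E`, hence a
division ring, and it contains `H` and the variables (`CentralRat.compositum_eq_top`). So, for a
basis of `H` over `Z`, the coordinates in `E` of an element of `D` are given by expressions
`∑ aₛ x bₛ` (`DivisionSubring.exists_coord`). These expressions preserve `L`, whence `L` is
generated by `H` and the field `L ∩ E` (`DivisionSubring.le_of_forall_algebraMap_mem`). The same
coordinates turn linear relations over `H(g)` into relations over `Z(g)`, so an element of `E`
algebraic over `H(g)` is algebraic over `Z(g)`
(`DivisionSubring.isAlgebraic_of_isAlgebraicElem`).

It remains to see that `L ∩ E` is generated over `Z` by one element. For `n = 1` this is Lüroth's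
theorem. In general `L ∩ E` is algebraic over `Z(g)` with `g` nonconstant, and such a field embeds
in `Z(X)`, where Lüroth's theorem applies again: a Kronecker substitution `Tᵢ ↦ X ^ (N ^ i)` with
`N` large keeps `g` nonconstant, and it is defined on the local ring at its kernel, which is
integrally closed and contains `Z(g)`, hence contains `L ∩ E`
(`IntermediateField.exists_algHom_ratFunc`). The substitution works over finite fields too.
-/

/-! ### Linear endomorphisms of a division ring over its center -/

namespace DivisionRing

open scoped TensorProduct

/-- A division ring `H` finite-dimensional over its center is an Azumaya algebra: every
center-linear endomorphism is a sum of two-sided multiplications. Indeed `H` is a simple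
`H`-`H`-bimodule whose bimodule endomorphisms are multiplications by central elements, so the
Jacobson density theorem applies. -/
theorem exists_eq_sum_mul_mul {H : Type*} [DivisionRing H]
    [FiniteDimensional (Subring.center H) H] (φ : H →ₗ[Subring.center H] H) :
    ∃ S : Finset (H × Hᵐᵒᵖ), ∀ x, φ x = ∑ s ∈ S, s.1 * x * s.2.unop := by
  classical
  let _ : Module (H ⊗[Subring.center H] Hᵐᵒᵖ) H := TensorProduct.Algebra.module
  have hsmul : ∀ (a : H) (b : Hᵐᵒᵖ) (x : H), (a ⊗ₜ[Subring.center H] b) • x = a * x * b.unop :=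
    fun a b x => by
      change AlgHom.mulLeftRight _ H (a ⊗ₜ b) x = _
      rw [AlgHom.mulLeftRight_apply]
  have hsimple : IsSimpleModule (H ⊗[Subring.center H] Hᵐᵒᵖ) H := by
    rw [isSimpleModule_iff_toSpanSingleton_surjective]
    refine ⟨inferInstance, fun x hx y => ⟨(y * x⁻¹) ⊗ₜ 1, ?_⟩⟩
    simp [hsmul, hx]
  have hend : ∀ (e : Module.End (H ⊗[Subring.center H] Hᵐᵒᵖ) H) (x : H),
      e 1 ∈ Subring.center H ∧ e x = e 1 * x := fun e x => by
    have h1 : ∀ x, e x = x * e 1 := fun x => by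
      simpa [hsmul] using e.map_smul (x ⊗ₜ 1) 1
    have h2 : ∀ x, e x = e 1 * x := fun x => by
      simpa [hsmul] using e.map_smul (1 ⊗ₜ .op x) 1
    exact ⟨Subring.mem_center_iff.2 fun g => by rw [← h1, h2], h2 x⟩
  let f : Module.End (Module.End (H ⊗[Subring.center H] Hᵐᵒᵖ) H) H :=
    { toFun := φ
      map_add' := φ.map_add
      map_smul' := fun e x => by
        have := φ.map_smul ⟨e 1, (hend e x).1⟩ x
        simp only [Module.End.smul_def, RingHom.id_apply]
        rw [(hend e x).2, (hend e (φ x)).2]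
        exact this }
  let b := Module.finBasis (Subring.center H) H
  obtain ⟨r, hr⟩ := jacobson_density f (Finset.univ.image b)
  obtain ⟨S, rfl⟩ := TensorProduct.exists_finset r
  refine ⟨S, fun x => ?_⟩
  have key : φ = AlgHom.mulLeftRight _ H (∑ i ∈ S, i.1 ⊗ₜ i.2) :=
    b.ext fun i => hr (b i) (Finset.mem_image_of_mem _ (Finset.mem_univ i))
  rw [key, map_sum, LinearMap.sum_apply]
  simp

end DivisionRing

/-! ### Extensions of a division ring by central scalars -/

namespace DivisionSubring

variable {H D : Type*} [DivisionRing H] [DivisionRing D] [Algebra (Subring.center H) D]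
  [FiniteDimensional (Subring.center H) H]

section Compositum

variable (j : H →ₐ[Subring.center H] D) (M : Type*) [Field M] [Algebra (Subring.center H) M]
  [Algebra M D] [IsScalarTower (Subring.center H) M D]

/-- The algebra `H · M` is spanned over `M` by a basis of `H` over its center, so it is
finite-dimensional. -/
theorem adjoin_range_eq_span :
    Subalgebra.toSubmodule (Algebra.adjoin M (Set.range j)) =
      Submodule.span M (Set.range (j ∘ Module.finBasis (Subring.center H) H)) := by
  have hr : (Submonoid.closure (Set.range j) : Set D) = Set.range j :=
    congrArg SetLike.coe (Submonoid.closure_eq (MonoidHom.mrange (j : H →* D)))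
  rw [Algebra.adjoin_eq_span, hr]
  refine le_antisymm (Submodule.span_le.2 ?_)
    (Submodule.span_mono (Set.range_comp_subset_range _ _))
  rintro _ ⟨h, rfl⟩
  rw [← (Module.finBasis (Subring.center H) H).sum_repr h, map_sum]
  refine Submodule.sum_mem _ fun i _ => ?_
  rw [map_smul, ← algebraMap_smul M]
  exact Submodule.smul_mem _ _ (Submodule.subset_span ⟨i, rfl⟩)

/-- The division subring `H · M` of `D` generated by the image of `H` and a central field `M`. It
is the set of `M`-linear combinations of elements of `H`, since these form a domain
finite-dimensional over `M`. -/
def compositum : Subfield D :=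
  { (Algebra.adjoin M (Set.range j)).toSubring with
    inv_mem' := fun x (hx : x ∈ Algebra.adjoin M (Set.range j)) => by
      by_cases h0 : x = 0
      · simp [h0]
      have : FiniteDimensional M (Algebra.adjoin M (Set.range j)) := by
        change FiniteDimensional M (Subalgebra.toSubmodule (Algebra.adjoin M (Set.range j)))
        rw [adjoin_range_eq_span]
        exact FiniteDimensional.span_of_finite M (Set.finite_range _)
      obtain ⟨u, hu⟩ := FiniteDimensional.isUnit M
        (x := (⟨x, hx⟩ : Algebra.adjoin M (Set.range j))) fun h => h0 (congrArg Subtype.val h)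
      have h1 : x * (u⁻¹).1.1 = 1 := by
        have := congrArg Subtype.val u.mul_inv
        rwa [hu] at this
      change x⁻¹ ∈ Algebra.adjoin M (Set.range j)
      rw [← eq_inv_of_mul_eq_one_right h1]
      exact (u⁻¹).1.2 }

theorem mem_compositum_of_base (h : H) : j h ∈ compositum j M :=
  Algebra.subset_adjoin (Set.mem_range_self h)

theorem algebraMap_mem_compositum (c : M) : algebraMap M D c ∈ compositum j M :=
  Subalgebra.algebraMap_mem _ c

theorem exists_of_mem_compositum {x : D} (hx : x ∈ compositum j M) :
    ∃ c : Fin (Module.finrank (Subring.center H) H) → M,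
      ∑ i, c i • j (Module.finBasis (Subring.center H) H i) = x := by
  have hx' : x ∈ Subalgebra.toSubmodule (Algebra.adjoin M (Set.range j)) := hx
  rw [adjoin_range_eq_span] at hx'
  exact (Submodule.mem_span_range_iff_exists_fun M).1 hx'

end Compositum

variable (j : H →ₐ[Subring.center H] D) {E : Type*} [Field E] [Algebra E D]

/-- The coordinate functionals of `D = H ⊗ E` with respect to a basis of `H` over its center are
sums of two-sided multiplications by elements of `H`. -/
theorem exists_coord (i : Fin (Module.finrank (Subring.center H) H)) :
    ∃ φ : D →ₗ[E] D,
      (∀ c : Fin (Module.finrank (Subring.center H) H) → E,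
        φ (∑ l, c l • j (Module.finBasis (Subring.center H) H l)) = algebraMap E D (c i)) ∧
      ∀ L : Subfield D, (∀ h, j h ∈ L) → ∀ x ∈ L, φ x ∈ L := by
  obtain ⟨S, hS⟩ := DivisionRing.exists_eq_sum_mul_mul
    ((Algebra.linearMap (Subring.center H) H).comp
      ((Module.finBasis (Subring.center H) H).coord i))
  refine ⟨∑ s ∈ S, LinearMap.mulLeftRight E (j s.1, j s.2.unop), fun c => ?_, fun L hL x hx => ?_⟩
  · have h1 : ∀ l, ∑ s ∈ S, j s.1 * j (Module.finBasis (Subring.center H) H l) * j s.2.unop =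
        if l = i then 1 else 0 := fun l => by
      simp_rw [← map_mul, ← map_sum, ← hS]
      by_cases h : l = i <;> simp [h]
    simp only [map_sum, map_smul, LinearMap.sum_apply, LinearMap.mulLeftRight_apply, h1]
    simp [Algebra.algebraMap_eq_smul_one]
  · rw [LinearMap.sum_apply]
    refine sum_mem fun s _ => ?_
    rw [LinearMap.mulLeftRight_apply]
    exact mul_mem (mul_mem (hL _) hx) (hL _)

variable [Algebra (Subring.center H) E] [IsScalarTower (Subring.center H) E D]

/-- A division ring between `H` and `D = H · E` is generated by `H` and its elements in `E`. -/
theorem le_of_forall_algebraMap_mem (hD : compositum j E = ⊤) {L N : Subfield D}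
    (hL : ∀ h, j h ∈ L) (hN : ∀ h, j h ∈ N)
    (hLN : ∀ c : E, algebraMap E D c ∈ L → algebraMap E D c ∈ N) : L ≤ N := by
  intro x hx
  obtain ⟨c, rfl⟩ := exists_of_mem_compositum j E (x := x) (hD ▸ Subfield.mem_top x)
  refine sum_mem fun i _ => ?_
  rw [Algebra.smul_def]
  refine mul_mem (hLN _ ?_) (hN _)
  obtain ⟨φ, h1, h2⟩ := exists_coord (E := E) j i
  rw [← h1 c]
  exact h2 L hL _ hx

open IntermediateField in
/-- An element of the central field `E` that is algebraic over `H(g)` is algebraic over `Z(H)(g)`: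
elements of `E` linearly independent over `Z(H)(g)` stay independent over `H · Z(H)(g)`. -/
theorem isAlgebraic_of_isAlgebraicElem {g x : E} {N : Subfield D}
    (hN : N ≤ compositum j (Subring.center H)⟮g⟯)
    (hx : IsAlgebraicElem N (algebraMap E D x)) :
    IsAlgebraic (Subring.center H)⟮g⟯ x := by
  obtain ⟨V, hV, hfin⟩ := hx
  by_contra htr
  have hxN : algebraMap E D x ∈ adjoin N {algebraMap E D x} :=
    Subfield.subset_closure (Or.inr rfl)
  have hpow : ∀ m : ℕ, algebraMap E D x ^ m ∈ V := fun m => by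
    rw [← SetLike.mem_coe, hV]
    exact pow_mem hxN m
  suffices hli : LinearIndependent N fun m : ℕ => algebraMap E D x ^ m from
    Module.Finite.not_linearIndependent_of_infinite
      (fun m : ℕ => (⟨algebraMap E D x ^ m, hpow m⟩ : V)) (.of_comp V.subtype hli)
  rw [linearIndependent_iff']
  intro s a ha m hm
  choose c hc using fun m => exists_of_mem_compositum j _ (hN (a m).2)
  -- Taking coordinates turns a relation over `N` into relations over `Z(H)(g)`.
  have hzero : ∀ i, c m i = 0 := fun i => by
    obtain ⟨φ, hφ, -⟩ := exists_coord (E := E) j i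
    have h1 : ∀ m, φ (a m • algebraMap E D x ^ m) = algebraMap E D ((c m i : E) * x ^ m) :=
      fun m => by
        have h2 : a m • algebraMap E D x ^ m = x ^ m • (a m : D) := by
          rw [Algebra.smul_def, map_pow, ← map_pow, Algebra.commutes]
          rfl
        rw [h2, map_smul, ← hc m, Algebra.smul_def, mul_comm (c m i : E), map_mul]
        exact congrArg _ (hφ fun l => (c m l : E))
    have h3 := congrArg φ ha
    simp only [map_sum, h1, map_zero] at h3
    rw [← map_sum, map_eq_zero] at h3
    have h4 : ∑ m ∈ s, Polynomial.monomial m (c m i) = 0 := by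
      by_contra hne
      refine htr ⟨_, hne, ?_⟩
      rw [map_sum, ← h3]
      refine Finset.sum_congr rfl fun m _ => ?_
      rw [Polynomial.aeval_monomial]
      rfl
    have h5 := congrArg (Polynomial.coeff · m) h4
    simpa [Polynomial.finsetSum_coeff, Polynomial.coeff_monomial, hm] using h5
  refine Subtype.ext ?_
  rw [← hc m]
  simp [hzero]

end DivisionSubring

/-! ### One-dimensional subfields of purely transcendental extensions -/

namespace MvPolynomial

variable {k : Type*} [Field k] {n : ℕ}

/-- The Kronecker substitution `Tᵢ ↦ X ^ (N ^ i)`. -/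
noncomputable def kronecker (k : Type*) [Field k] (n N : ℕ) :
    MvPolynomial (Fin n) k →ₐ[k] Polynomial k :=
  aeval fun i => Polynomial.X ^ (N ^ (i : ℕ))

theorem kronecker_apply (N : ℕ) (p : MvPolynomial (Fin n) k) :
    kronecker k n N p =
      ∑ m ∈ p.support, Polynomial.monomial (∑ i, m i * N ^ (i : ℕ)) (p.coeff m) := by
  rw [kronecker, aeval_def, eval₂_eq']
  refine Finset.sum_congr rfl fun m _ => ?_
  rw [← Polynomial.C_mul_X_pow_eq_monomial, Polynomial.algebraMap_eq]
  congr 1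
  rw [← Finset.prod_pow_eq_pow_sum]
  exact Finset.prod_congr rfl fun i _ => by rw [← pow_mul, mul_comm]

/-- The Kronecker substitution is injective on polynomials of degree below `N`, by uniqueness of
expansions in base `N`. -/
theorem eq_zero_of_kronecker_eq_zero {N : ℕ} {p : MvPolynomial (Fin n) k}
    (hp : p.totalDegree < N) (h : kronecker k n N p = 0) : p = 0 := by
  classical
  ext m
  rw [coeff_zero]
  by_contra hm
  have hlt : ∀ m ∈ p.support, ∀ i, m i < N := fun m hm i =>
    (Finsupp.le_degree i m).trans_lt ((le_totalDegree hm).trans_lt hp)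
  have hm' : m ∈ p.support := mem_support_iff.2 hm
  have hc := congrArg (Polynomial.coeff · (∑ i, m i * N ^ (i : ℕ))) h
  simp only [kronecker_apply, Polynomial.finsetSum_coeff, Polynomial.coeff_monomial,
    Polynomial.coeff_zero] at hc
  rw [Finset.sum_eq_single m, if_pos rfl] at hc
  · exact hm hc
  · intro m' hm'' hne
    refine if_neg fun heq => hne ?_
    have := (finFunctionFinEquiv (m := N) (n := n)).injective
      (a₁ := fun i => ⟨m' i, hlt m' hm'' i⟩) (a₂ := fun i => ⟨m i, hlt m hm' i⟩)
      (Fin.ext (by simpa [finFunctionFinEquiv_apply] using heq))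
    ext i
    simpa using congrArg Fin.val (congrFun this i)
  · exact fun h => absurd hm' h

end MvPolynomial

namespace IntermediateField

variable {k E : Type*} [Field k] [Field E] [Algebra k E]

/-- Lüroth's theorem for a subfield that embeds in `k(X)`. -/
theorem exists_eq_adjoin_simple_of_algHom {M : IntermediateField k E} (θ : M →ₐ[k] RatFunc k) :
    ∃ f, M = k⟮f⟯ := by
  have h := RatFunc.Luroth.eq_adjoin_generator (E := θ.fieldRange)
  obtain ⟨f, hf⟩ := RatFunc.Luroth.generator_mem (E := θ.fieldRange)
  refine ⟨f, ?_⟩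
  have h1 : (k⟮f⟯).map θ = (⊤ : IntermediateField k M).map θ := by
    rw [adjoin_map, Set.image_singleton, ← AlgHom.fieldRange_eq_map]
    conv_rhs => rw [h]
    exact congrArg (fun x => k⟮x⟯) hf
  have h2 : k⟮f⟯ = ⊤ := map_injective θ h1
  have h3 := congrArg lift h2
  rw [lift_top, lift_adjoin_simple] at h3
  exact h3.symm

open Polynomial in
/-- A subfield `M` of `k(T₁, …, Tₙ)` that is algebraic over `k(g)` for a nonconstant `g` embeds in
`k(X)`. The Kronecker substitution of a large degree keeps `g` nonconstant; let `P` be its kernel.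
The local ring at `P` contains `k(g)`, hence also `M`, because it is integrally closed. -/
theorem exists_algHom_ratFunc {n : ℕ} [Algebra (MvPolynomial (Fin n) k) E]
    [IsScalarTower k (MvPolynomial (Fin n) k) E] [IsFractionRing (MvPolynomial (Fin n) k) E]
    {M : IntermediateField k E} {g : E} (hg : g ∉ (⊥ : IntermediateField k E))
    (hM : ∀ x ∈ M, IsAlgebraic k⟮g⟯ x) : Nonempty (M →ₐ[k] RatFunc k) := by
  obtain ⟨a, b, hb, hgab⟩ := IsFractionRing.div_surjective (A := MvPolynomial (Fin n) k) g
  have hinj := IsFractionRing.injective (MvPolynomial (Fin n) k) E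
  have hb0 : b ≠ 0 := nonZeroDivisors.ne_zero hb
  have hbE : algebraMap (MvPolynomial (Fin n) k) E b ≠ 0 := (map_ne_zero_iff _ hinj).2 hb0
  let N := max a.totalDegree b.totalDegree + 1
  let φ : MvPolynomial (Fin n) k →ₐ[k] RatFunc k :=
    (IsScalarTower.toAlgHom k k[X] (RatFunc k)).comp (MvPolynomial.kronecker k n N)
  have hφ : ∀ p : MvPolynomial (Fin n) k, p.totalDegree < N → φ p = 0 → p = 0 := fun p hp h =>
    MvPolynomial.eq_zero_of_kronecker_eq_zero hp
      ((map_eq_zero_iff _ (IsFractionRing.injective k[X] (RatFunc k))).1 h)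
  have hφb : φ b ≠ 0 := fun h => hb0 (hφ b (Nat.lt_succ_of_le (le_max_right _ _)) h)
  -- The image of `g` under the substitution is not a constant.
  have hγ : ¬ ∃ c, φ a / φ b = RatFunc.C c := by
    rintro ⟨c, hc⟩
    rw [div_eq_iff hφb] at hc
    have h0 : a - MvPolynomial.C c * b = 0 := by
      refine hφ _ ?_ ?_
      · refine Nat.lt_succ_of_le ((MvPolynomial.totalDegree_sub _ _).trans (max_le_max le_rfl ?_))
        rw [← MvPolynomial.smul_eq_C_mul]
        exact MvPolynomial.totalDegree_smul_le _ _
      · rw [map_sub, map_mul, ← MvPolynomial.algebraMap_eq, AlgHom.commutes, sub_eq_zero, hc]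
        rfl
    apply hg
    rw [IntermediateField.mem_bot]
    refine ⟨c, ?_⟩
    rw [← hgab, eq_div_iff hbE, sub_eq_zero.1 h0, map_mul, ← MvPolynomial.algebraMap_eq,
      ← IsScalarTower.algebraMap_apply]
  let P : Ideal (MvPolynomial (Fin n) k) := RingHom.ker φ
  have hP : P.IsPrime := RingHom.ker_isPrime _
  have hPc : ∀ p, p ∈ P.primeCompl ↔ φ p ≠ 0 := fun p => Iff.rfl
  let A := Localization.subalgebra.ofField E P.primeCompl P.primeCompl_le_nonZeroDivisors
  have hAloc : IsLocalization P.primeCompl A :=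
    Localization.subalgebra.isLocalization_ofField E _ _
  have hAfrac : IsFractionRing A E := Localization.subalgebra.isFractionRing_ofField E _ _
  have hAint : IsIntegrallyClosed A :=
    isIntegrallyClosed_of_isLocalization A P.primeCompl P.primeCompl_le_nonZeroDivisors
  let ev : A →+* RatFunc k := IsLocalization.lift (M := P.primeCompl) (g := φ.toRingHom)
    fun y => IsUnit.mk0 _ y.2
  have hev : ∀ p, ev (algebraMap _ A p) = φ p := fun p => IsLocalization.lift_eq _ p
  have hevC : ∀ c : k, ev (algebraMap k A c) = algebraMap k (RatFunc k) c := fun c => by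
    rw [IsScalarTower.algebraMap_apply k (MvPolynomial (Fin n) k) A, hev, AlgHom.commutes]
  let evₐ : A →ₐ[k] RatFunc k := { ev with commutes' := hevC }
  -- An element of the local ring that is not killed by the substitution is invertible in it.
  have hinv : ∀ x : A, ev x ≠ 0 → (x : E)⁻¹ ∈ A := by
    rintro ⟨x, p, s, hs, rfl⟩ hx
    refine ⟨s, p, (hPc p).2 fun hp => hx ?_, by rw [mul_inv_rev, inv_inv]⟩
    have hsE : algebraMap (MvPolynomial (Fin n) k) E s ≠ 0 :=
      (map_ne_zero_iff _ hinj).2 fun h => (hPc s).1 hs (by rw [h, map_zero])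
    refine (mul_eq_zero (b := φ s).1 ?_).resolve_right ((hPc s).1 hs)
    rw [← hev, ← map_mul, ← hp, ← hev]
    exact congrArg ev (Subtype.ext (inv_mul_cancel_right₀ hsE _))
  have hgA : g ∈ A := ⟨a, b, (hPc b).2 hφb, by rw [← hgab, div_eq_mul_inv]⟩
  have hevg : evₐ ⟨g, hgA⟩ = φ a / φ b := by
    rw [eq_div_iff hφb, ← hev, ← hev]
    refine (map_mul ev _ _).symm.trans (congrArg ev (Subtype.ext ?_))
    exact (div_eq_iff hbE).1 hgab |>.symm
  -- By transcendence of the image of `g`, the denominator of an element of `k(g)` survives.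
  have hkg : ∀ y ∈ k⟮g⟯, y ∈ A := fun y hy => by
    obtain ⟨r, s, rfl⟩ := (mem_adjoin_simple_iff k y).1 hy
    have haeval : ∀ r : k[X], aeval g r = ((aeval (⟨g, hgA⟩ : A) r : A) : E) := fun r =>
      aeval_algebraMap_apply E (⟨g, hgA⟩ : A) r
    by_cases hs : s = 0
    · rw [hs, map_zero, div_zero]
      exact zero_mem A
    · rw [div_eq_mul_inv, haeval r, haeval s]
      refine mul_mem (aeval (⟨g, hgA⟩ : A) r).2 (hinv _ ?_)
      change evₐ _ ≠ 0
      rw [← aeval_algHom_apply, hevg]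
      exact fun h => hs (by
        by_contra hs
        exact RatFunc.transcendental_of_ne_C _ hγ ⟨s, hs, h⟩)
  have hMA : ∀ x ∈ M, x ∈ A := fun x hx => by
    let incl : k⟮g⟯ →+* A :=
      { toFun := fun y => ⟨y, hkg y y.2⟩
        map_one' := rfl
        map_mul' := fun _ _ => rfl
        map_zero' := rfl
        map_add' := fun _ _ => rfl }
    have hint : IsIntegral A x :=
      RingHom.IsIntegralElem.of_comp (f := incl) (g := algebraMap A E) (x := x)
        (hM x hx).isIntegral
    obtain ⟨y, rfl⟩ := IsIntegrallyClosed.isIntegral_iff.1 hint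
    exact y.2
  exact ⟨evₐ.comp
    { toFun := fun x : M => (⟨x, hMA x x.2⟩ : A)
      map_one' := rfl
      map_mul' := fun _ _ => rfl
      map_zero' := rfl
      map_add' := fun _ _ => rfl
      commutes' := fun _ => rfl }⟩

/-- **Lüroth's theorem** for subfields of `k(T₁, …, Tₙ)` of transcendence degree one: a subfield
that is algebraic over `k(g)` for some nonconstant `g` is generated by one element. -/
theorem exists_eq_adjoin_simple_of_isAlgebraic {n : ℕ} [Algebra (MvPolynomial (Fin n) k) E]
    [IsScalarTower k (MvPolynomial (Fin n) k) E] [IsFractionRing (MvPolynomial (Fin n) k) E]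
    {M : IntermediateField k E} {g : E} (hg : g ∉ (⊥ : IntermediateField k E))
    (hM : ∀ x ∈ M, IsAlgebraic k⟮g⟯ x) : ∃ f, M = k⟮f⟯ :=
  exists_eq_adjoin_simple_of_algHom (exists_algHom_ratFunc (n := n) hg hM).some

/-- Lüroth's theorem, for the fraction field of a polynomial ring indexed by `Fin 1`. -/
theorem exists_eq_adjoin_simple_of_fin_one [Algebra (MvPolynomial (Fin 1) k) E]
    [IsScalarTower k (MvPolynomial (Fin 1) k) E] [IsFractionRing (MvPolynomial (Fin 1) k) E]
    (M : IntermediateField k E) : ∃ f, M = k⟮f⟯ :=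
  exists_eq_adjoin_simple_of_algHom <|
    (IsFractionRing.algEquivOfAlgEquiv (K := E) (L := RatFunc k)
      (MvPolynomial.uniqueAlgEquiv k (Fin 1))).toAlgHom.comp M.val

end IntermediateField

/-! ### The central subfield of rational functions -/

namespace CentralRat

variable (H : Type*) [DivisionRing H] (n : ℕ)

theorem mem_center_of_forall_ofPoly {x : CentralRat H n}
    (h : ∀ p, ofPoly H n p * x = x * ofPoly H n p) : x ∈ Subring.center (CentralRat H n) := by
  refine Subring.mem_center_iff.2 fun y => ?_
  obtain ⟨a, b, -, rfl⟩ := exists_eq_mul_inv y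
  have hb : Commute (ofPoly H n b)⁻¹ x := Commute.inv_left₀ (h b)
  exact Commute.mul_left (h a) hb

theorem T_mem_center (i : Fin n) : T H i ∈ Subring.center (CentralRat H n) := by
  refine mem_center_of_forall_ofPoly H n fun p => ?_
  rw [T, ← map_mul, ← map_mul]
  congr 1
  induction p using AddMonoidAlgebra.induction_linear with
  | zero => simp
  | add p q hp hq => rw [add_mul, mul_add, hp, hq]
  | single m a => simp [AddMonoidAlgebra.single_mul_single, add_comm]

theorem C_mem_center {z : H} (hz : z ∈ Subring.center H) :
    C H n z ∈ Subring.center (CentralRat H n) := by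
  refine mem_center_of_forall_ofPoly H n fun p => ?_
  rw [C, RingHom.comp_apply, ← map_mul, ← map_mul]
  congr 1
  induction p using AddMonoidAlgebra.induction_linear with
  | zero => simp
  | add p q hp hq => rw [add_mul, mul_add, hp, hq]
  | single m a =>
    simp [AddMonoidAlgebra.single_mul_single, Subring.mem_center_iff.1 hz a]

/-- The inclusion of `Z(H)` in the center of `H(T₁, …, Tₙ)`. -/
noncomputable def centerC : Subring.center H →+* Subring.center (CentralRat H n) :=
  ((C H n).comp (Subring.center H).subtype).codRestrict _ fun z => C_mem_center H n z.2

/-- The inclusion of `Z(H)[T₁, …, Tₙ]` in the center of `H(T₁, …, Tₙ)`. -/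
noncomputable def centerPoly :
    MvPolynomial (Fin n) (Subring.center H) →+* Subring.center (CentralRat H n) :=
  MvPolynomial.eval₂Hom (centerC H n) fun i => ⟨T H i, T_mem_center H n i⟩

theorem coe_centerPoly (p : MvPolynomial (Fin n) (Subring.center H)) :
    (centerPoly H n p : CentralRat H n) =
      ofPoly H n (AddMonoidAlgebra.mapRingHom _ (Subring.center H).subtype p) := by
  refine congrArg (fun f : MvPolynomial (Fin n) (Subring.center H) →+* CentralRat H n => f p)
    (MvPolynomial.ringHom_ext (f := (Subring.center _).subtype.comp (centerPoly H n))
      (g := (ofPoly H n).comp (AddMonoidAlgebra.mapRingHom _ (Subring.center H).subtype))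
      (fun z => ?_) fun i => ?_)
  · simp only [RingHom.comp_apply, centerPoly, MvPolynomial.coe_eval₂Hom, MvPolynomial.eval₂_C]
    refine congrArg (ofPoly H n) ?_
    exact (AddMonoidAlgebra.mapRingHom_single _ _ _).symm
  · simp only [RingHom.comp_apply, centerPoly, MvPolynomial.coe_eval₂Hom, MvPolynomial.eval₂_X]
    refine congrArg (ofPoly H n) ?_
    exact (AddMonoidAlgebra.mapRingHom_single (M := Fin n →₀ ℕ) (Subring.center H).subtype
      (Finsupp.single i 1) 1).symm

theorem centerPoly_injective : Function.Injective (centerPoly H n) := by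
  rw [injective_iff_map_eq_zero]
  intro p hp
  have h := (coe_centerPoly H n p).symm.trans (congrArg Subtype.val hp)
  rw [ZeroMemClass.coe_zero, map_eq_zero_iff _ (ofPoly_injective H n)] at h
  ext m
  have hm := congrArg (fun q => AddMonoidAlgebra.coeff q m) h
  simp only [AddMonoidAlgebra.coeff_mapRingHom] at hm
  exact hm

theorem ofPoly_single (m : Fin n →₀ ℕ) (a : H) :
    ofPoly H n (AddMonoidAlgebra.single m a) =
      C H n a * centerPoly H n (MvPolynomial.monomial m 1) := by
  rw [coe_centerPoly, C, RingHom.comp_apply, ← map_mul]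
  refine congrArg (ofPoly H n) ?_
  have : AddMonoidAlgebra.mapRingHom _ (Subring.center H).subtype
      (MvPolynomial.monomial m (1 : Subring.center H)) = AddMonoidAlgebra.single m (1 : H) :=
    AddMonoidAlgebra.mapRingHom_single _ _ _
  rw [this]
  simp [AddMonoidAlgebra.single_mul_single]

/-- The field `Z(H)(T₁, …, Tₙ)`, as an abstract fraction field. -/
abbrev CenterField : Type _ := FractionRing (MvPolynomial (Fin n) (Subring.center H))

/-- The inclusion of `Z(H)(T₁, …, Tₙ)` in the center of `H(T₁, …, Tₙ)`. -/
noncomputable def centerFieldHom : CenterField H n →+* Subring.center (CentralRat H n) :=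
  IsFractionRing.lift (centerPoly_injective H n)

noncomputable instance : Algebra (CenterField H n) (CentralRat H n) :=
  RingHom.toAlgebra' ((Subring.center _).subtype.comp (centerFieldHom H n)) fun c x =>
    (Subring.mem_center_iff.1 (centerFieldHom H n c).2 x).symm

noncomputable instance : Algebra (Subring.center H) (CentralRat H n) :=
  RingHom.toAlgebra' ((Subring.center _).subtype.comp (centerC H n)) fun c x =>
    (Subring.mem_center_iff.1 (centerC H n c).2 x).symm

theorem algebraMap_algebraMap (p : MvPolynomial (Fin n) (Subring.center H)) :
    algebraMap (CenterField H n) (CentralRat H n) (algebraMap _ _ p) = centerPoly H n p :=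
  congrArg Subtype.val (IsFractionRing.lift_algebraMap (centerPoly_injective H n) p)

theorem algebraMap_X (i : Fin n) :
    algebraMap (CenterField H n) (CentralRat H n)
      (algebraMap (MvPolynomial (Fin n) (Subring.center H)) _ (MvPolynomial.X i)) = T H i := by
  rw [algebraMap_algebraMap, centerPoly, MvPolynomial.coe_eval₂Hom, MvPolynomial.eval₂_X]

theorem centerPoly_C (z : Subring.center H) :
    (centerPoly H n (MvPolynomial.C z) : CentralRat H n) = C H n z := by
  rw [centerPoly, MvPolynomial.coe_eval₂Hom, MvPolynomial.eval₂_C]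
  rfl

instance : IsScalarTower (Subring.center H) (CenterField H n) (CentralRat H n) :=
  .of_algebraMap_eq fun z => by
    rw [IsScalarTower.algebraMap_apply _ (MvPolynomial (Fin n) (Subring.center H)) (CenterField H n),
      algebraMap_algebraMap, MvPolynomial.algebraMap_eq, centerPoly_C]
    rfl

/-- The inclusion of `H` in `H(T₁, …, Tₙ)`, as a map of algebras over `Z(H)`. -/
noncomputable def baseHom : H →ₐ[Subring.center H] CentralRat H n :=
  { C H n with commutes' := fun _ => rfl }

/-- The abstract field `Z(H)(T₁, …, Tₙ)` maps onto the division subring of that name. -/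
theorem range_algebraMap :
    (algebraMap (CenterField H n) (CentralRat H n)).fieldRange = centerRat H n := by
  apply le_antisymm
  · have hp : ∀ p, (centerPoly H n p : CentralRat H n) ∈ centerRat H n := fun p => by
      induction p using MvPolynomial.induction_on with
      | C z =>
        rw [centerPoly_C]
        exact Subfield.subset_closure (Or.inl ⟨z, z.2, rfl⟩)
      | add p q hp hq =>
        rw [map_add]
        exact add_mem hp hq
      | mul_X p i hp =>
        rw [map_mul]
        refine mul_mem (S := Subfield (CentralRat H n)) hp ?_
        rw [← algebraMap_algebraMap, algebraMap_X]
        exact Subfield.subset_closure (Or.inr ⟨i, rfl⟩)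
    rintro _ ⟨x, rfl⟩
    obtain ⟨a, b, -, rfl⟩ :=
      IsFractionRing.div_surjective (A := MvPolynomial (Fin n) (Subring.center H)) x
    rw [map_div₀, algebraMap_algebraMap, algebraMap_algebraMap]
    exact div_mem (hp a) (hp b)
  · rw [centerRat, Subfield.closure_le]
    rintro _ (⟨z, hz, rfl⟩ | ⟨i, rfl⟩)
    · exact ⟨algebraMap (Subring.center H) _ ⟨z, hz⟩,
        (IsScalarTower.algebraMap_apply _ _ _ _).symm⟩
    · exact ⟨_, algebraMap_X H n i⟩

/-- `H(T₁, …, Tₙ) = H · Z(H)(T₁, …, Tₙ)`: fractions of polynomials over `H` need no denominators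
outside `Z(H)[T₁, …, Tₙ]`. -/
theorem compositum_eq_top [FiniteDimensional (Subring.center H) H] :
    DivisionSubring.compositum (baseHom H n) (CenterField H n) = ⊤ := by
  refine top_unique fun x _ => ?_
  have hp : ∀ p, ofPoly H n p ∈ DivisionSubring.compositum (baseHom H n) (CenterField H n) := by
    intro p
    induction p using AddMonoidAlgebra.induction_linear with
    | zero => simp
    | add p q hp hq => rw [map_add]; exact add_mem hp hq
    | single m a =>
      rw [ofPoly_single]
      refine mul_mem (DivisionSubring.mem_compositum_of_base _ _ a) ?_
      rw [← algebraMap_algebraMap]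
      exact DivisionSubring.algebraMap_mem_compositum _ _ _
  obtain ⟨a, b, -, rfl⟩ := exists_eq_mul_inv x
  exact mul_mem (hp a) (inv_mem (hp b))


theorem algebraMap_mem_centerBase_iff {x : CenterField H n} :
    algebraMap (CenterField H n) (CentralRat H n) x ∈ centerBase H n ↔
      x ∈ (⊥ : IntermediateField (Subring.center H) (CenterField H n)) := by
  rw [IntermediateField.mem_bot]
  constructor
  · rintro ⟨z, hz, h⟩
    refine ⟨⟨z, hz⟩, (algebraMap (CenterField H n) (CentralRat H n)).injective ?_⟩
    rw [← h, ← IsScalarTower.algebraMap_apply]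
    rfl
  · rintro ⟨z, rfl⟩
    rw [← IsScalarTower.algebraMap_apply]
    exact ⟨z, z.2, rfl⟩

end CentralRat

/-! ### Intermediate division rings -/

namespace CentralRat

variable {H : Type*} [DivisionRing H] {n : ℕ}

/-- The elements of a division ring `L ⊇ H` that lie in `Z(H)(T₁, …, Tₙ)`, as an intermediate field
of `Z(H)(T₁, …, Tₙ)/Z(H)`. -/
noncomputable def centralPart (L : Subfield (CentralRat H n)) (hL : base H n ≤ L) :
    IntermediateField (Subring.center H) (CenterField H n) :=
  (L.comap (algebraMap (CenterField H n) (CentralRat H n))).toIntermediateField fun z => by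
    rw [Subfield.mem_comap, ← IsScalarTower.algebraMap_apply]
    exact hL ⟨z, rfl⟩

theorem mem_centralPart {L : Subfield (CentralRat H n)} (hL : base H n ≤ L)
    {x : CenterField H n} :
    x ∈ centralPart L hL ↔ algebraMap (CenterField H n) (CentralRat H n) x ∈ L := Iff.rfl

theorem base_le_adjoin (S : Set (CentralRat H n)) :
    base H n ≤ DivisionSubring.adjoin (base H n) S :=
  fun _ hx => Subfield.subset_closure (Or.inl hx)

open IntermediateField in
theorem eq_adjoin_of_centralPart_eq [FiniteDimensional (Subring.center H) H]
    {L : Subfield (CentralRat H n)} (hL : base H n ≤ L) {f : CenterField H n}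
    (hf : centralPart L hL = (Subring.center H)⟮f⟯) :
    L = DivisionSubring.adjoin (base H n) {algebraMap (CenterField H n) (CentralRat H n) f} := by
  apply le_antisymm
  · refine DivisionSubring.le_of_forall_algebraMap_mem (baseHom H n) (compositum_eq_top H n)
      (fun h => hL ⟨h, rfl⟩) (fun h => base_le_adjoin _ ⟨h, rfl⟩) fun c hc => ?_
    have hle : (Subring.center H)⟮f⟯ ≤ centralPart _ (base_le_adjoin _) :=
      adjoin_simple_le_iff.2 ((mem_centralPart _).2 (Subfield.subset_closure
        (Or.inr (Set.mem_singleton (algebraMap (CenterField H n) (CentralRat H n) f)))))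
    exact (mem_centralPart _).1 (hle (hf ▸ (mem_centralPart hL).2 hc))
  · refine Subfield.closure_le.2 (Set.union_subset hL (Set.singleton_subset_iff.2 ?_))
    exact (mem_centralPart hL).1 (hf ▸ mem_adjoin_simple_self _ f)

theorem le_base_of_centralPart_eq_bot [FiniteDimensional (Subring.center H) H]
    {L : Subfield (CentralRat H n)} (hL : base H n ≤ L) (h : centralPart L hL = ⊥) :
    L ≤ base H n := by
  refine DivisionSubring.le_of_forall_algebraMap_mem (baseHom H n) (compositum_eq_top H n)
    (fun h => hL ⟨h, rfl⟩) (fun h => ⟨h, rfl⟩) fun c hc => ?_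
  obtain ⟨z, -, hz⟩ := (algebraMap_mem_centerBase_iff H n).2 (h ▸ (mem_centralPart hL).2 hc)
  exact ⟨z, hz⟩

open IntermediateField in
theorem adjoin_le_compositum [FiniteDimensional (Subring.center H) H] (g : CenterField H n) :
    DivisionSubring.adjoin (base H n) {algebraMap (CenterField H n) (CentralRat H n) g} ≤
      DivisionSubring.compositum (baseHom H n) (Subring.center H)⟮g⟯ := by
  refine Subfield.closure_le.2 (Set.union_subset ?_ (Set.singleton_subset_iff.2 ?_))
  · rintro _ ⟨h, rfl⟩
    exact DivisionSubring.mem_compositum_of_base (baseHom H n) _ h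
  · exact DivisionSubring.algebraMap_mem_compositum (baseHom H n) (Subring.center H)⟮g⟯
      ⟨g, mem_adjoin_simple_self _ g⟩

end CentralRat

theorem DivisionSubring.isAlgebraicElem_of_mem {K : Type*} [DivisionRing K] {F : Subfield K}
    {x : K} (hx : x ∈ F) : IsAlgebraicElem F x := by
  have h : adjoin F {x} = F := by
    rw [adjoin, Set.union_eq_self_of_subset_right (Set.singleton_subset_iff.2 hx),
      Subfield.closure_eq]
  refine ⟨Submodule.span F {1}, ?_, inferInstance⟩
  rw [h]
  ext y
  rw [SetLike.mem_coe, Submodule.mem_span_singleton]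
  constructor
  · rintro ⟨a, rfl⟩
    rw [Subfield.smul_def, smul_eq_mul, mul_one]
    exact a.2
  · exact fun hy => ⟨⟨y, hy⟩, by rw [Subfield.smul_def, smul_eq_mul, mul_one]⟩

theorem theorem1p1 {H : Type*} [DivisionRing H] [FiniteDimensional (Subring.center H) H]
    {n : ℕ} (hn : 0 < n) (L : Subfield (CentralRat H n)) (hL : CentralRat.base H n ≤ L) :
    (n = 1 → L ≠ CentralRat.base H n →
      ∃ f ∈ CentralRat.centerRat H n, f ∉ CentralRat.centerBase H n ∧
        L = DivisionSubring.adjoin (CentralRat.base H n) {f}) ∧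
    ((∃ g ∈ CentralRat.centerRat H n,
        DivisionSubring.IsAlgebraicExt (DivisionSubring.adjoin (CentralRat.base H n) {g}) L ∧
        ¬ DivisionSubring.IsAlgebraicElem (CentralRat.base H n) g) →
      ∃ f ∈ CentralRat.centerRat H n, f ∉ CentralRat.centerBase H n ∧
        L = DivisionSubring.adjoin (CentralRat.base H n) {f}) := by
  -- It suffices to generate the central part of `L`.
  have key : (∃ f, CentralRat.centralPart L hL =
        IntermediateField.adjoin (Subring.center H) {f}) → CentralRat.centralPart L hL ≠ ⊥ →
      ∃ f ∈ CentralRat.centerRat H n, f ∉ CentralRat.centerBase H n ∧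
        L = DivisionSubring.adjoin (CentralRat.base H n) {f} := by
    rintro ⟨f, hf⟩ hbot
    refine ⟨algebraMap (CentralRat.CenterField H n) _ f, ?_, fun h => hbot ?_,
      CentralRat.eq_adjoin_of_centralPart_eq hL hf⟩
    · rw [← CentralRat.range_algebraMap]
      exact ⟨f, rfl⟩
    · rw [hf]
      exact IntermediateField.adjoin_simple_eq_bot_iff.2
        ((CentralRat.algebraMap_mem_centerBase_iff H n).1 h)
  constructor
  · rintro rfl hne
    refine key (IntermediateField.exists_eq_adjoin_simple_of_fin_one _) fun h => hne ?_
    exact le_antisymm (CentralRat.le_base_of_centralPart_eq_bot hL h) hL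
  · rintro ⟨g, hg, ⟨hgL, halg⟩, htr⟩
    rw [← CentralRat.range_algebraMap] at hg
    obtain ⟨g, rfl⟩ := hg
    have hgbot : g ∉ (⊥ : IntermediateField (Subring.center H) (CentralRat.CenterField H n)) := by
      intro h
      obtain ⟨z, -, hz⟩ := (CentralRat.algebraMap_mem_centerBase_iff H n).2 h
      exact htr (DivisionSubring.isAlgebraicElem_of_mem ⟨z, hz⟩)
    refine key (IntermediateField.exists_eq_adjoin_simple_of_isAlgebraic (n := n) hgbot
      fun x hx => ?_)
      fun h => hgbot (h ▸ (CentralRat.mem_centralPart hL).2 (hgL ?_))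
    · exact DivisionSubring.isAlgebraic_of_isAlgebraicElem (CentralRat.baseHom H n)
        (CentralRat.adjoin_le_compositum g) (halg _ ((CentralRat.mem_centralPart hL).1 hx))
    · exact Subfield.subset_closure (Or.inr rfl)
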